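/- Let $G=(V,E)$ be a finite simple graph with $n=|V|$ vertices, let $E'\subseteq E$ be a nonempty set of candidate edges, and let $\Delta_\infty>0$, $\rho>0$ and $\lambda=\frac{\sqrt{2\rho}}{4\Delta_\infty}$. The graph and $E'$ are public; the weights $w:E\to\mathbb R$ are private. Write $\mathrm{Exp}(\lambda)$ for the exponential distribution with rate $\lambda$, $\mathrm{MaxExp}(k,\lambda)$ for the law of the maximum of $k$ independent $\mathrm{Exp}(\lambda)$ variables, and $\lfloor x\rfloor_s=s\lfloor x/s\rfloor$ for $s>0$. The mechanism Faster-Discretized-Report-Noisy-Max, on weights $w$, works as follows. 1. Set $\tilde w(e)=\lfloor w(e)\rfloor_{\Delta_\infty}$, $M=4\sqrt n\,\log (n)\,\Delta_\infty/\sqrt\rho$ (natural logarithm), $\tilde M=\max_{e\in E'}\tilde w(e)$ and $L=\{e\in E' : \tilde w(e)<\tilde M-M\}$. 2. Partition $E'\setminus L$ into groups $F_i$ of edges with equal discretized weight $\tilde w_{F_i}$. For every group, independently, draw $Z_i\sim\mathrm{MaxExp}(|F_i|,\lambda)$ and, independently of it, a uniformly random edge $r_i\in F_i$; the edge $r_i$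 gets the score $\tilde w_{F_i}+Z_i$, and the other edges of $F_i$ do not compete. 3. Independently of step 2, draw $k\sim\mathrm{Bin}(|L|,e^{-\lambda M})$, then a uniformly random subset $I\subseteq L$ of size $k$, and then independent $Y_e\sim\mathrm{Exp}(\lambda)$ for $e\in I$; an edge $e\in L$ gets the score $\tilde w(e)+M+Y_e$ if $e\in I$ and $\tilde w(e)+M$ otherwise. 4. Return the edge with the largest score. Then the following two statements hold. (a) For every $w:E\to\mathbb R$, the law of the returned edge is equal to the output law of Discretized-RNM with $s=\Delta_\infty$ and $\varepsilon=\sqrt{2\rho}$, that is, to the law of $$\arg\max_{e\in E'}\Big(\lfloor w(e)\rfloor_{s}+X_e\Big),\qquad X_e\sim\mathrm{Exp}\Big(\frac{\varepsilon}{2(\Delta_\infty+s)}\Big)\ \text{independent}.$$ (b) The mechanism is $\rho$-zCDP with respect to $\ell_\infty$-neighboring weights: if $P_w$ denotes its output law on weights $w$, then for all $w,w':E\to\mathbb R$ with $|w(e)-w'(e)|\le\Delta_\infty$ for every $e\in E$, and for all real $\alpha>1$, $$D_\alpha(P_w\,\|\,P_{w'})\le\rho\,\alpha ,$$ where $D_\alpha(P\|Q)=\frac1{\alpha-1}\log\int\big(\frac{dP}{dQ}\big)^{\alpha}\,dQ$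 is the Rényi divergence, which is $+\infty$ if $P$ is not absolutely continuous with respect to $Q$. (Ties in an $\arg\max$ are broken by a fixed arbitrary rule depending only on the set of maximizers.) -/

import Mathlib

open MeasureTheory ProbabilityTheory

noncomputable section

/-- Sets of (undirected) edges carry the discrete σ-algebra. -/
instance instMeasurableSpaceSym2 (V : Type*) : MeasurableSpace (Sym2 V) := ⊤

instance instDiscreteMeasurableSpaceSym2 (V : Type*) :
    DiscreteMeasurableSpace (Sym2 V) := ⟨fun _ => trivial⟩

/-! ### Privacy -/

/-- The Rényi divergence `D_a(μ ‖ ν) = (a - 1)⁻¹ log ∫ (dμ/dν)^a dν` of order `a > 1`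
(equal to `∞` when `μ` is not absolutely continuous with respect to `ν`). -/
def renyiDiv {Ω : Type*} [MeasurableSpace Ω] (a : ℝ) (μ ν : Measure Ω) : EReal :=
  open Classical in
  if μ ≪ ν then ((a - 1)⁻¹ : ℝ) * ENNReal.log (∫⁻ x, (μ.rnDeriv ν x) ^ a ∂ν) else ⊤

/-- A randomized mechanism `𝓜`, sending each input to the law of its output, is `ρ`-zCDP for the
neighboring relation `nbr`. -/
def IsZCDP {X Ω : Type*} [MeasurableSpace Ω] (nbr : X → X → Prop) (ρ : ℝ)
    (𝓜 : X → Measure Ω) : Prop :=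
  (∀ x, IsProbabilityMeasure (𝓜 x)) ∧
    ∀ x x', nbr x x' → ∀ a : ℝ, 1 < a → renyiDiv a (𝓜 x) (𝓜 x') ≤ ((ρ * a : ℝ) : EReal)

/-- `ℓ_∞`-neighboring weight functions: every edge weight changes by at most `Δ`. -/
def LInftyNeighboring {E : Type*} (Δ : ℝ) (w w' : E → ℝ) : Prop :=
  ∀ e, |w e - w' e| ≤ Δ

/-! ### Discretization, `argmax`, and the reference mechanism -/

/-- Round `x` down to an integer multiple of `s`. -/
def roundDown (s x : ℝ) : ℝ := s * (⌊x / s⌋ : ℝ)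

/-- A maximizer of `score`. Ties are broken by a fixed arbitrary choice, depending only on the
set of all maximizers. -/
def argmax {α β : Type*} [Nonempty α] [LE β] (score : α → β) : α :=
  Classical.epsilon fun a => a ∈ {a | ∀ b, score b ≤ score a}

/-- The output law of Discretized-RNM: add independent exponential noise of rate
`ε / (2 (Δ + s))` to each weight rounded down to a multiple of `s`, and return the `argmax`. -/
def discretizedRNM {α : Type*} [Fintype α] [Nonempty α] [MeasurableSpace α]
    (ε Δ s : ℝ) (w : α → ℝ) : Measure α :=
  (Measure.pi fun _ : α => expMeasure (ε / (2 * (Δ + s)))).map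
    fun z => argmax fun e => roundDown s (w e) + z e

/-! ### The fast simulation -/

/-- `MaxExp(k, lam)`: the law of the maximum of `k ≥ 1` independent exponential variables of rate
`lam`. -/
def maxExp (k : ℕ) (lam : ℝ) : Measure ℝ :=
  (Measure.pi fun _ : Fin k => expMeasure lam).map fun x => ⨆ i, x i

section Algorithm

variable {α : Type*} [Fintype α]

open Classical in
/-- The bottom set `L = {e | w e < max w - M}`. -/
def bottomSet [Nonempty α] (w : α → ℝ) (M : ℝ) : Finset α :=
  Finset.univ.filter fun e => w e < Finset.univ.sup' Finset.univ_nonempty w - M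

open Classical in
/-- The finitely many weights taken outside the bottom set; each of them indexes a top group. -/
def topValues [Nonempty α] (w : α → ℝ) (M : ℝ) : Finset ℝ :=
  (bottomSet w M)ᶜ.image w

open Classical in
/-- The group of all candidates of weight `v`. -/
def group (w : α → ℝ) (v : ℝ) : Finset α := Finset.univ.filter fun e => w e = v

open Classical in
/-- The noise vector on a finite set `β` of bottom candidates: sample `k ∼ Bin(|β|, exp(-lam M))`,
then a uniformly random `I ⊆ β` of size `k`; the noise is `M + Exp(lam)`, independently, on `I`,
and is `M` off `I`. (`Set.projIcc` only regards `exp(-lam M) ≤ 1` as a point of `[0, 1]`.) -/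
def bottomNoise (β : Type*) [Fintype β] (lam M : ℝ) : Measure (β → ℝ) :=
  (binomial (Fintype.card β) (Set.projIcc 0 1 zero_le_one (Real.exp (-(lam * M))))).bind fun k =>
    (uniformOn {I : Finset β | I.card = k}).bind fun I =>
      (Measure.pi fun _ : I => expMeasure lam).map
        fun Y e => if h : e ∈ I then M + Y ⟨e, h⟩ else M

open Classical in
/-- The scores compared in the last step, given the group noises `Z`, the chosen representatives
`r` of the top groups, and the bottom noise `b`. In a top group, only the representative competes,
with the noise of its group; the other members have score `⊥`. -/
def combinedScore [Nonempty α] (w : α → ℝ) (M : ℝ) (Z : topValues w M → ℝ)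
    (r : topValues w M → α) (b : bottomSet w M → ℝ) (e : α) : EReal :=
  if h : e ∈ bottomSet w M then ((w e + b ⟨e, h⟩ : ℝ) : EReal)
  else
    let v : topValues w M :=
      ⟨w e, Finset.mem_image_of_mem w (Finset.mem_compl.mpr h)⟩
    if r v = e then ((w e + Z v : ℝ) : EReal) else ⊥

/-- The output law of the simulation on (already discretized) weights `w` with noise rate `lam` and
threshold `M`: independently, each top group gets one noise term `MaxExp(|group|, lam)` and one
uniformly random representative, and the bottom set gets the noise `bottomNoise`; the overall
`argmax` is returned. -/
def fastRNM [Nonempty α] [MeasurableSpace α] (lam M : ℝ) (w : α → ℝ) : Measure α :=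
  ((Measure.pi fun v : topValues w M => maxExp (group w v).card lam).prod
    ((Measure.pi fun v : topValues w M => uniformOn (group w v : Set α)).prod
      (bottomNoise (bottomSet w M) lam M))).map
    fun ω => argmax (combinedScore w M ω.1 ω.2.1 ω.2.2)

/-- The output law of Faster-Discretized-Report-Noisy-Max with privacy parameters `lam` and `ρ` and
sensitivity `Δ`, for a graph on `n` vertices, where `w` holds the weights of the candidates. -/
def fasterDiscretizedRNM [Nonempty α] [MeasurableSpace α] (n : ℕ) (lam ρ Δ : ℝ) (w : α → ℝ) :
    Measure α :=
  fastRNM lam (4 * √(n : ℝ) * Real.log n * Δ / √ρ) fun e => roundDown Δ (w e)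

end Algorithm

end

/-!
The simulation is coupled with report-noisy-max. Attach one exponential variable `z e` to every
candidate and read the random choices of the simulation off from `z`: in each top group the maximum
and the maximizer of `z`, and on the bottom set the truncated noise `max M (z e)`
(`simulationCoupling`). Two things have to be checked.

* These statistics have the law that the simulation draws from (`map_simulationCoupling`). Different
  groups and the bottom set involve disjoint blocks of the independent variables
  (`pi_map_blocks`). Within a group, the maximum is `MaxExp` and is independent of the maximizer,
  which is uniform, because exchanging two variables changes neither the product law nor the
  maximum (`pi_map_iSup_argmax`). On the bottom set, an exponential variable truncated at `M` is `M`
  with probability `1 - exp (-r M)` and otherwise `M` plus a fresh exponential variable, by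
  memorylessness (`expMeasure_map_max`); a subset of binomial size chosen uniformly contains every
  element independently (`lintegral_uniformOn_binomial`), which gives `bottomNoise_eq_pi`.
* With these choices the simulation returns the winner of report-noisy-max, off the null event of
  ties or negative noise (`argmax_combinedScore`): the winning score is at least the largest weight,
  and a bottom candidate whose noise was truncated stays below that.

Privacy is then a property of report-noisy-max. A shift of one exponential variable by `c` distorts
its law by a factor at most `exp (r c)` (`map_add_expMeasure_le`), and such a shift by twice the
sensitivity turns a winner for one weight function into a winner for a neighboring one, so the
output laws are within `exp ε` of each other (`discretizedRNM_le_smul`). Finally Hoeffding's lemma,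
applied to the log-likelihood ratio, turns this into the bound `a ε² / 2` on the Rényi divergence of
order `a` (`renyiDiv_le_of_le_smul`), and `ε² / 2 = ρ` for `ε = √(2 ρ)`.
-/

/-! ### From pure differential privacy to zCDP -/

/-- A bound `μ ≤ c • ν` between measures bounds the density `dμ/dν` by `c`. -/
lemma rnDeriv_le_of_le_smul {Ω : Type*} [MeasurableSpace Ω] {μ ν : Measure Ω} [SigmaFinite μ]
    [SigmaFinite ν] {c : ENNReal} (h : μ ≤ c • ν) : ∀ᵐ x ∂ν, μ.rnDeriv ν x ≤ c := by
  refine ae_le_of_forall_setLIntegral_le_of_sigmaFinite (μ.measurable_rnDeriv ν) fun s _ _ => ?_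
  calc ∫⁻ x in s, μ.rnDeriv ν x ∂ν ≤ μ s := Measure.setLIntegral_rnDeriv_le s
    _ ≤ (c • ν) s := h s
    _ = ∫⁻ _ in s, c ∂ν := by simp

lemma llr_le_of_le_smul {Ω : Type*} [MeasurableSpace Ω] {μ ν : Measure Ω} [SigmaFinite μ]
    [SigmaFinite ν] {ε : ℝ} (hμν : μ ≪ ν) (h : μ ≤ ENNReal.ofReal (Real.exp ε) • ν) :
    ∀ᵐ x ∂μ, llr μ ν x ≤ ε := by
  filter_upwards [hμν.ae_le (rnDeriv_le_of_le_smul h), Measure.rnDeriv_pos hμν,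
    hμν.ae_le (Measure.rnDeriv_lt_top μ ν)] with x hx hpos htop
  rw [llr, Real.log_le_iff_le_exp (ENNReal.toReal_pos hpos.ne' htop.ne)]
  exact ENNReal.toReal_le_of_le_ofReal (Real.exp_pos _).le hx

/-- If `μ` and `ν` are within a factor `exp ε` of each other, then `D_a(μ ‖ ν) ≤ a ε² / 2`.
Under `μ` the privacy loss `Y = log (dμ/dν)` has values in `[-ε, ε]`, so Hoeffding's lemma bounds
all exponential moments of `Y - 𝔼 Y`. At `-1`, where `𝔼 exp (-Y) = 1`, this bound says that
`𝔼 Y ≤ ε² / 2`; at `a - 1` it then bounds the moment in the Rényi divergence. -/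
theorem renyiDiv_le_of_le_smul {Ω : Type*} [MeasurableSpace Ω] {μ ν : Measure Ω}
    [IsProbabilityMeasure μ] [IsProbabilityMeasure ν] {ε a : ℝ} (ha : 1 < a)
    (hμν : μ ≤ ENNReal.ofReal (Real.exp ε) • ν) (hνμ : ν ≤ ENNReal.ofReal (Real.exp ε) • μ) :
    renyiDiv a μ ν ≤ ((ε ^ 2 / 2 * a : ℝ) : EReal) := by
  have hac : μ ≪ ν := Measure.absolutelyContinuous_of_le_smul hμν
  have hac' : ν ≪ μ := Measure.absolutelyContinuous_of_le_smul hνμ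
  have hmem : ∀ᵐ x ∂μ, llr μ ν x ∈ Set.Icc (-ε) ε := by
    filter_upwards [llr_le_of_le_smul hac hμν, hac.ae_le (llr_le_of_le_smul hac' hνμ),
      neg_llr hac] with x h1 h2 h3
    rw [← h3, Pi.neg_apply] at h2
    exact ⟨by linarith, h1⟩
  have hY : AEMeasurable (llr μ ν) μ := (measurable_llr μ ν).aemeasurable
  have hsub := hasSubgaussianMGF_of_mem_Icc hY hmem
  set m := ∫ x, llr μ ν x ∂μ with hm
  have hc : ((((‖ε - -ε‖₊ / 2) ^ 2 : NNReal)) : ℝ) = ε ^ 2 := by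
    have : ((‖ε - -ε‖₊ : NNReal) : ℝ) = |2 * ε| := by
      rw [coe_nnnorm, Real.norm_eq_abs]; ring_nf
    rw [NNReal.coe_pow, NNReal.coe_div, this, div_pow, sq_abs]
    push_cast
    ring
  have hmgf : ∀ t : ℝ, ∫ x, Real.exp (t * llr μ ν x) ∂μ ≤ Real.exp (t * m + ε ^ 2 * t ^ 2 / 2) := by
    intro t
    have h := hsub.mgf_le t
    rw [hc, mgf] at h
    calc ∫ x, Real.exp (t * llr μ ν x) ∂μ
        = ∫ x, Real.exp (t * m) * Real.exp (t * (llr μ ν x - m)) ∂μ := by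
          congr with x
          rw [← Real.exp_add]
          ring_nf
      _ = Real.exp (t * m) * ∫ x, Real.exp (t * (llr μ ν x - m)) ∂μ := integral_const_mul _ _
      _ ≤ Real.exp (t * m) * Real.exp (ε ^ 2 * t ^ 2 / 2) := by gcongr
      _ = _ := (Real.exp_add _ _).symm
  have hmean : m ≤ ε ^ 2 / 2 := by
    have h := hmgf (-1)
    have h1 : ∫ x, Real.exp (-1 * llr μ ν x) ∂μ = 1 := by
      have h2 : (fun x => Real.exp (-1 * llr μ ν x)) =ᵐ[μ] fun x => (ν.rnDeriv μ x).toReal := by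
        simpa using exp_neg_llr hac
      rw [integral_congr_ae h2, Measure.integral_toReal_rnDeriv hac', probReal_univ]
    rw [h1, Real.one_le_exp_iff] at h
    linarith
  have hmom : ∫⁻ x, (μ.rnDeriv ν x) ^ a ∂ν
      = ENNReal.ofReal (∫ x, Real.exp ((a - 1) * llr μ ν x) ∂μ) := by
    rw [ofReal_integral_eq_lintegral_ofReal (integrable_exp_mul_of_mem_Icc hY hmem)
      (ae_of_all _ fun _ => (Real.exp_pos _).le),
      ← lintegral_rnDeriv_mul hac (by fun_prop)]
    refine lintegral_congr_ae ?_
    filter_upwards [Measure.rnDeriv_lt_top μ ν] with x htop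
    rcases eq_or_ne (μ.rnDeriv ν x) 0 with h0 | h0
    · rw [h0, zero_mul, ENNReal.zero_rpow_of_pos (by linarith)]
    · have hp : 0 < (μ.rnDeriv ν x).toReal := ENNReal.toReal_pos h0 htop.ne
      have : Real.exp ((a - 1) * llr μ ν x) = (μ.rnDeriv ν x).toReal ^ (a - 1) := by
        rw [Real.rpow_def_of_pos hp, llr, mul_comm]
      rw [this, ← ENNReal.ofReal_rpow_of_pos hp, ENNReal.ofReal_toReal htop.ne]
      conv_lhs => rw [show a = 1 + (a - 1) by ring, ENNReal.rpow_add _ _ h0 htop.ne,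
        ENNReal.rpow_one]
  have hlog : ENNReal.log (∫⁻ x, (μ.rnDeriv ν x) ^ a ∂ν)
      ≤ (((a - 1) * (ε ^ 2 / 2 * a) : ℝ) : EReal) := by
    rw [hmom, ← Real.log_exp ((a - 1) * (ε ^ 2 / 2 * a)),
      ← ENNReal.log_ofReal_of_pos (Real.exp_pos _)]
    refine ENNReal.log_le_log (ENNReal.ofReal_le_ofReal ((hmgf (a - 1)).trans ?_))
    rw [Real.exp_le_exp]
    nlinarith [mul_le_mul_of_nonneg_left hmean (sub_pos.2 ha).le]
  rw [renyiDiv, if_pos hac]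
  calc (((a - 1)⁻¹ : ℝ) : EReal) * ENNReal.log (∫⁻ x, (μ.rnDeriv ν x) ^ a ∂ν)
      ≤ (((a - 1)⁻¹ : ℝ) : EReal) * (((a - 1) * (ε ^ 2 / 2 * a) : ℝ) : EReal) :=
        mul_le_mul_of_nonneg_left hlog
          (by exact_mod_cast inv_nonneg.2 (sub_pos.2 ha).le)
    _ = ((ε ^ 2 / 2 * a : ℝ) : EReal) := by
        rw [← EReal.coe_mul, inv_mul_cancel_left₀ (sub_pos.2 ha).ne']

/-! ### Exponential noise -/

/-- The exponential distribution has no atoms. -/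
lemma nullSingletonClass_expMeasure (r : ℝ) : NullSingletonClass (expMeasure r) := by
  rw [expMeasure, gammaMeasure]
  infer_instance

lemma expMeasure_eq_withDensity (r : ℝ) :
    expMeasure r = volume.withDensity (exponentialPDF r) := rfl

lemma ae_nonneg_expMeasure (r : ℝ) : ∀ᵐ x ∂expMeasure r, 0 ≤ x := by
  rw [ae_iff, expMeasure_eq_withDensity]
  simp only [not_le]
  change volume.withDensity (exponentialPDF r) (Set.Iio 0) = 0
  rw [withDensity_apply _ measurableSet_Iio]
  exact lintegral_exponentialPDF_of_nonpos le_rfl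

/-- Shifting an exponential variable to the right by `c` costs at most a factor `exp (r c)`. -/
lemma map_add_expMeasure_le {r c : ℝ} (hc : 0 ≤ c) :
    (expMeasure r).map (· + c) ≤ ENNReal.ofReal (Real.exp (r * c)) • expMeasure r := by
  have hm : Measurable (exponentialPDF r) := (measurable_exponentialPDFReal r).ennreal_ofReal
  refine Measure.le_iff.2 fun s hs => ?_
  rw [Measure.map_apply (measurable_add_const c) hs, Measure.smul_apply,
    expMeasure_eq_withDensity, withDensity_apply _ (measurable_add_const c hs),
    withDensity_apply _ hs, smul_eq_mul, ← lintegral_const_mul _ hm,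
    ← lintegral_indicator (measurable_add_const c hs), ← lintegral_indicator hs,
    ← lintegral_add_right_eq_self (s.indicator _) c]
  refine lintegral_mono fun x => ?_
  by_cases hx : x + c ∈ s
  · rw [Set.indicator_of_mem (show x ∈ (· + c) ⁻¹' s from hx), Set.indicator_of_mem hx]
    rcases lt_or_ge x 0 with h0 | h0
    · rw [exponentialPDF_of_neg h0]
      exact zero_le
    · rw [exponentialPDF_of_nonneg h0, exponentialPDF_of_nonneg (by linarith),
        ← ENNReal.ofReal_mul (Real.exp_pos _).le, mul_left_comm, ← Real.exp_add]
      ring_nf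
      exact le_rfl
  · rw [Set.indicator_of_notMem (show x ∉ (· + c) ⁻¹' s from hx)]
    exact zero_le

/-! ### Product measures -/

/-- The coordinates of a product of copies of `μ` indexed by `ι`, read along an injection `κ → ι`,
are again distributed as a product of copies of `μ`. -/
lemma pi_map_comp_injective {ι κ X : Type*} [Fintype ι] [Fintype κ] [MeasurableSpace X]
    (μ : Measure X) [IsProbabilityMeasure μ] {e : κ → ι} (he : Function.Injective e) :
    (Measure.pi fun _ : ι => μ).map (fun x j => x (e j)) = Measure.pi fun _ : κ => μ := by
  have h : iIndepFun (fun (i : ι) (x : ι → X) => x i) (Measure.pi fun _ : ι => μ) :=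
    iIndepFun_pi (X := fun _ => id) fun _ => aemeasurable_id
  rw [(h.precomp he).map_fun_eq_pi_map fun j => (measurable_pi_apply _).aemeasurable]
  congr with j : 1
  exact (measurePreserving_eval (fun _ : ι => μ) (e j)).map_eq

/-- Transforming one coordinate by `g` distorts a product measure at most as much as `g` distorts
the law of that coordinate. -/
lemma pi_map_update_le {ι X : Type*} [Fintype ι] [DecidableEq ι] [MeasurableSpace X]
    (μ : Measure X) [IsProbabilityMeasure μ] {g : X → X} (hg : Measurable g) {k : ENNReal}
    (h : μ.map g ≤ k • μ) (a : ι) :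
    (Measure.pi fun _ : ι => μ).map (fun x => Function.update x a (g (x a)))
      ≤ k • Measure.pi fun _ : ι => μ := by
  have hmeas : Measurable fun x : ι → X => Function.update x a (g (x a)) := by
    refine measurable_pi_iff.2 fun i => ?_
    rcases eq_or_ne i a with rfl | hi
    · simpa [Function.comp_def] using hg.comp (measurable_pi_apply i)
    · simpa [Function.update_of_ne hi] using measurable_pi_apply i
  refine Measure.le_iff.2 fun s hs => ?_
  obtain ⟨x₀⟩ : Nonempty X := nonempty_of_isProbabilityMeasure μ
  set f : (ι → X) → ENNReal := s.indicator 1 with hf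
  have hfm : Measurable f := measurable_one.indicator hs
  rw [Measure.smul_apply, smul_eq_mul, ← lintegral_indicator_one hs,
    ← lintegral_indicator_one hs, lintegral_map hfm hmeas, ← lintegral_const_mul _ hfm,
    lintegral_eq_lmarginal_univ (fun _ => x₀), lintegral_eq_lmarginal_univ (fun _ => x₀),
    lmarginal_erase' (fun x => f (Function.update x a (g (x a)))) (hfm.comp hmeas)
      (Finset.mem_univ a),
    lmarginal_erase' _ (hfm.const_mul k) (Finset.mem_univ a)]
  refine lmarginal_mono (fun x => ?_) _
  have hu : Measurable fun y => f (Function.update x a y) := hfm.comp (measurable_update x)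
  calc ∫⁻ y, f (Function.update (Function.update x a y) a (g (Function.update x a y a))) ∂μ
      = ∫⁻ y, f (Function.update x a (g y)) ∂μ := by simp
    _ = ∫⁻ y, f (Function.update x a y) ∂(μ.map g) := (lintegral_map hu hg).symm
    _ ≤ ∫⁻ y, f (Function.update x a y) ∂(k • μ) := lintegral_mono' h le_rfl
    _ = ∫⁻ y, k * f (Function.update x a y) ∂μ := by
        rw [lintegral_smul_measure, smul_eq_mul, lintegral_const_mul _ hu]

/-- Independent variables with atomless law almost surely produce no ties. -/
lemma ae_pi_no_ties {ι : Type*} [Fintype ι] (μ : Measure ℝ) [IsProbabilityMeasure μ]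
    [NullSingletonClass μ] (w : ι → ℝ) :
    ∀ᵐ x ∂Measure.pi (fun _ : ι => μ), ∀ i j, i ≠ j → w i + x i ≠ w j + x j := by
  refine ae_all_iff.2 fun i => ae_all_iff.2 fun j => ?_
  by_cases hij : i = j
  · simp [hij]
  have hindep : IndepFun (fun x : ι → ℝ => x i) (fun x => x j) (Measure.pi fun _ : ι => μ) :=
    (iIndepFun_pi (X := fun _ => id) fun _ => aemeasurable_id).indepFun hij
  have hlaw := (indepFun_iff_map_prod_eq_prod_map_map (measurable_pi_apply i).aemeasurable
    (measurable_pi_apply j).aemeasurable).1 hindep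
  have he : ∀ i, (Measure.pi fun _ : ι => μ).map (fun x => x i) = μ :=
    fun i => (measurePreserving_eval (fun _ : ι => μ) i).map_eq
  rw [he i, he j] at hlaw
  have hS : MeasurableSet {p : ℝ × ℝ | w i + p.1 = w j + p.2} :=
    measurableSet_eq_fun (by fun_prop) (by fun_prop)
  have h0 : μ.prod μ {p : ℝ × ℝ | w i + p.1 = w j + p.2} = 0 := by
    rw [Measure.measure_prod_null hS]
    refine ae_of_all _ fun x => ?_
    have : Prod.mk x ⁻¹' {p : ℝ × ℝ | w i + p.1 = w j + p.2} = {w i + x - w j} := by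
      ext y
      simp only [Set.mem_preimage, Set.mem_ofPred_eq, Set.mem_singleton_iff]
      constructor <;> intro h <;> linarith
    simp [this]
  rw [← hlaw, Measure.map_apply (by fun_prop) hS] at h0
  filter_upwards [compl_mem_ae_iff.2 h0] with x hx _ h
  exact hx h

/-! ### Maximizers -/

section Argmax

variable {α : Type*} [Nonempty α]

lemma argmax_eq_of_forall_lt {β : Type*} [Preorder β] {score : α → β} {a : α}
    (h : ∀ b, b ≠ a → score b < score a) : argmax score = a := by
  have hex : ∃ a, a ∈ {a | ∀ b, score b ≤ score a} := by
    refine ⟨a, fun b => ?_⟩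
    rcases eq_or_ne b a with rfl | hb
    · exact le_rfl
    · exact (h b hb).le
  by_contra hne
  have := Classical.epsilon_spec hex a
  exact (h _ hne).not_ge this

lemma le_argmax [Finite α] {β : Type*} [LinearOrder β] (score : α → β) (b : α) :
    score b ≤ score (argmax score) :=
  Classical.epsilon_spec (p := fun a => a ∈ {a | ∀ b, score b ≤ score a})
    (Finite.exists_max score) b

/-- `argmax` is measurable, since it depends only on the set of maximizers. -/
lemma measurable_argmax [Finite α] [MeasurableSpace α] {β : Type*} [LinearOrder β]
    [TopologicalSpace β] [OrderClosedTopology β] [SecondCountableTopology β] [MeasurableSpace β]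
    [OpensMeasurableSpace β] : Measurable (argmax : (α → β) → α) := by
  have h1 : Measurable fun score : α → β => {a | ∀ b, score b ≤ score a} := by
    refine measurable_set_iff.2 fun a => Measurable.forall fun b => measurableSet_setOfPred.1 ?_
    exact measurableSet_le (f := fun score : α → β => score b) (g := fun score => score a)
      (measurable_pi_apply b) (measurable_pi_apply a)
  have h2 : Measurable fun S : Set α => Classical.epsilon fun a => a ∈ S := .of_discrete
  exact h2.comp h1

end Argmax

/-! ### Privacy of report-noisy-max with exponential noise -/

section Privacy

variable {α : Type*} [Fintype α] [Nonempty α] [MeasurableSpace α]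

lemma measurable_argmax_add (v : α → ℝ) :
    Measurable fun z : α → ℝ => argmax fun e => v e + z e :=
  measurable_argmax.comp (measurable_pi_iff.2 fun e => (measurable_pi_apply e).const_add _)

/-- On a finite discrete space, measures are compared on points. -/
lemma le_of_singleton_le {α : Type*} [Finite α] [MeasurableSpace α] [MeasurableSingletonClass α]
    {μ ν : Measure α} (h : ∀ a, μ {a} ≤ ν {a}) : μ ≤ ν := by
  refine Measure.le_iff.2 fun s _ => ?_
  have hs : s = ((Set.toFinite s).toFinset : Set α) := by simp
  rw [hs, ← sum_measure_singleton, ← sum_measure_singleton]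
  exact Finset.sum_le_sum fun a _ => h a

/-- If the weights `v` and `v'` differ by at most `D`, then report-noisy-max on `v` and on `v'`
have laws within a factor `exp (2 r D)`: adding `2 D` to the noise of a winner for `v` makes it a
winner for `v'`, and ties have probability zero. -/
theorem noisyMax_le_smul [MeasurableSingletonClass α] {r D : ℝ} (hr : 0 < r) (hD : 0 ≤ D)
    {v v' : α → ℝ} (h : ∀ e, |v e - v' e| ≤ D) :
    (Measure.pi fun _ : α => expMeasure r).map (fun z => argmax fun e => v e + z e)
      ≤ ENNReal.ofReal (Real.exp (r * (2 * D))) •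
        (Measure.pi fun _ : α => expMeasure r).map (fun z => argmax fun e => v' e + z e) := by
  classical
  have := isProbabilityMeasure_expMeasure hr
  have := nullSingletonClass_expMeasure r
  set P := Measure.pi fun _ : α => expMeasure r
  refine le_of_singleton_le fun a => ?_
  rw [Measure.map_apply (measurable_argmax_add v) (measurableSet_singleton a),
    Measure.smul_apply, Measure.map_apply (measurable_argmax_add v') (measurableSet_singleton a)]
  -- `W` is the event that `a` is a weak winner for `v'`
  set W : Set (α → ℝ) := {z | ∀ b, v' b + z b ≤ v' a + z a} with hW
  have hWm : MeasurableSet W := by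
    simp only [hW, Set.ofPred_forall]
    exact MeasurableSet.iInter fun b => measurableSet_le (by fun_prop) (by fun_prop)
  have hmeas : Measurable fun z : α → ℝ => Function.update z a (z a + 2 * D) := by
    refine measurable_pi_iff.2 fun i => ?_
    rcases eq_or_ne i a with rfl | hi
    · simpa using (measurable_pi_apply i).add_const _
    · simpa [Function.update_of_ne hi] using measurable_pi_apply i
  calc P ((fun z => argmax fun e => v e + z e) ⁻¹' {a})
      ≤ P ((fun z => Function.update z a (z a + 2 * D)) ⁻¹' W) := by
        refine measure_mono fun z hz b => ?_
        have hz : argmax (fun e => v e + z e) = a := hz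
        have hb := le_argmax (fun e => v e + z e) b
        rw [hz] at hb
        rcases eq_or_ne b a with rfl | hba
        · exact le_rfl
        · have h1 := abs_le.1 (h a)
          have h2 := abs_le.1 (h b)
          simp only [Function.update_self, Function.update_of_ne hba]
          linarith
    _ = P.map (fun z => Function.update z a (z a + 2 * D)) W :=
        (Measure.map_apply hmeas hWm).symm
    _ ≤ (ENNReal.ofReal (Real.exp (r * (2 * D))) • P) W :=
        pi_map_update_le _ (measurable_add_const (2 * D))
          (map_add_expMeasure_le (by positivity)) a W
    _ ≤ ENNReal.ofReal (Real.exp (r * (2 * D))) •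
        P ((fun z => argmax fun e => v' e + z e) ⁻¹' {a}) := by
        rw [Measure.smul_apply]
        refine smul_le_smul_of_nonneg_left (measure_mono_ae ?_) zero_le
        filter_upwards [ae_pi_no_ties (expMeasure r) v'] with z hz hzW
        exact argmax_eq_of_forall_lt fun b hb => lt_of_le_of_ne (hzW b) (hz b a hb)

/-- Rounding down to multiples of `s` keeps `s`-close numbers `s`-close. -/
lemma abs_roundDown_sub_le {s x y : ℝ} (hs : 0 < s) (h : |x - y| ≤ s) :
    |roundDown s x - roundDown s y| ≤ s := by
  have hxy := abs_le.1 h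
  have key : ∀ {x y : ℝ}, x ≤ y + s → ⌊x / s⌋ ≤ ⌊y / s⌋ + 1 := fun {x y} h => by
    rw [← Int.floor_add_one]
    refine Int.floor_le_floor ?_
    rw [div_add_one hs.ne']
    gcongr
  have h1 : ((⌊x / s⌋ : ℤ) : ℝ) ≤ ⌊y / s⌋ + 1 := by exact_mod_cast key (by linarith)
  have h2 : ((⌊y / s⌋ : ℤ) : ℝ) ≤ ⌊x / s⌋ + 1 := by exact_mod_cast key (by linarith)
  rw [roundDown, roundDown, ← mul_sub, abs_mul, abs_of_pos hs]
  exact mul_le_of_le_one_right hs.le (abs_le.2 ⟨by linarith, by linarith⟩)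

lemma isProbabilityMeasure_discretizedRNM {ε Δ s : ℝ} (h : 0 < ε / (2 * (Δ + s))) (w : α → ℝ) :
    IsProbabilityMeasure (discretizedRNM ε Δ s w) := by
  have := isProbabilityMeasure_expMeasure h
  exact Measure.isProbabilityMeasure_map (measurable_argmax_add _).aemeasurable

/-- Discretized report-noisy-max is `ε`-differentially private. -/
theorem discretizedRNM_le_smul [MeasurableSingletonClass α] {ε Δ : ℝ} (hε : 0 < ε) (hΔ : 0 < Δ)
    {w w' : α → ℝ} (h : LInftyNeighboring Δ w w') :
    discretizedRNM ε Δ Δ w ≤ ENNReal.ofReal (Real.exp ε) • discretizedRNM ε Δ Δ w' := by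
  have hle := noisyMax_le_smul (r := ε / (2 * (Δ + Δ))) (by positivity) hΔ.le
    (v := fun e => roundDown Δ (w e)) (v' := fun e => roundDown Δ (w' e))
    fun e => abs_roundDown_sub_le hΔ (h e)
  refine hle.trans ?_
  have : ε / (2 * (Δ + Δ)) * (2 * Δ) ≤ ε := by
    rw [show ε / (2 * (Δ + Δ)) * (2 * Δ) = ε / 2 by field_simp; ring]
    linarith
  rw [discretizedRNM]
  gcongr

end Privacy

/-! ### The noise of the bottom candidates -/

/-- Memorylessness: conditionally on exceeding `M`, an exponential variable is `M` plus a fresh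
exponential variable. -/
lemma expMeasure_restrict_Ici {r M : ℝ} (hM : 0 ≤ M) :
    (expMeasure r).restrict (Set.Ici M) =
      ENNReal.ofReal (Real.exp (-(r * M))) • (expMeasure r).map (M + ·) := by
  have hm : Measurable (exponentialPDF r) := (measurable_exponentialPDFReal r).ennreal_ofReal
  ext s hs
  rw [Measure.restrict_apply hs, Measure.smul_apply,
    Measure.map_apply (measurable_const_add M) hs, expMeasure_eq_withDensity,
    withDensity_apply _ (hs.inter measurableSet_Ici),
    withDensity_apply _ (measurable_const_add M hs), smul_eq_mul, ← lintegral_const_mul _ hm,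
    ← lintegral_indicator (hs.inter measurableSet_Ici),
    ← lintegral_indicator (measurable_const_add M hs),
    ← lintegral_add_left_eq_self ((s ∩ Set.Ici M).indicator _) M]
  refine lintegral_congr fun x => ?_
  rcases lt_or_ge x 0 with h0 | h0
  · rw [Set.indicator_of_notMem (fun h => by have := h.2; simp at this; linarith)]
    by_cases hx : x ∈ (M + ·) ⁻¹' s
    · rw [Set.indicator_of_mem hx, exponentialPDF_of_neg h0, mul_zero]
    · rw [Set.indicator_of_notMem hx]
  · by_cases hx : M + x ∈ s
    · rw [Set.indicator_of_mem (show M + x ∈ s ∩ Set.Ici M from ⟨hx, by simpa using h0⟩),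
        Set.indicator_of_mem (show x ∈ (M + ·) ⁻¹' s from hx), exponentialPDF_of_nonneg h0,
        exponentialPDF_of_nonneg (by linarith), ← ENNReal.ofReal_mul (Real.exp_pos _).le,
        mul_left_comm, ← Real.exp_add]
      ring_nf
    · rw [Set.indicator_of_notMem (fun h => hx h.1),
        Set.indicator_of_notMem (show x ∉ (M + ·) ⁻¹' s from hx)]

/-- An exponential variable truncated from below at `M` equals `M` with probability
`1 - exp (-r M)`, and otherwise `M` plus a fresh exponential variable. -/
lemma expMeasure_map_max {r M : ℝ} (hr : 0 < r) (hM : 0 ≤ M) :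
    (expMeasure r).map (max M) =
      ENNReal.ofReal (Real.exp (-(r * M))) • (expMeasure r).map (M + ·) +
        ENNReal.ofReal (1 - Real.exp (-(r * M))) • Measure.dirac M := by
  have := isProbabilityMeasure_expMeasure hr
  have hmax : Measurable (max M) := measurable_const.max measurable_id
  set p := Real.exp (-(r * M)) with hp
  have hIci : expMeasure r (Set.Ici M) = ENNReal.ofReal p := by
    have : IsProbabilityMeasure ((expMeasure r).map (M + ·)) :=
      Measure.isProbabilityMeasure_map (measurable_const_add M).aemeasurable
    rw [← Measure.restrict_apply_univ, expMeasure_restrict_Ici hM, Measure.smul_apply,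
      measure_univ, smul_eq_mul, mul_one]
  have hIio : expMeasure r (Set.Ici M)ᶜ = ENNReal.ofReal (1 - p) := by
    rw [prob_compl_eq_one_sub measurableSet_Ici, hIci, ENNReal.ofReal_sub _ (Real.exp_pos _).le,
      ENNReal.ofReal_one]
  have h1 : ((expMeasure r).restrict (Set.Ici M)).map (max M) =
      (expMeasure r).restrict (Set.Ici M) := by
    have : max M =ᵐ[(expMeasure r).restrict (Set.Ici M)] id := by
      filter_upwards [ae_restrict_mem measurableSet_Ici] with x hx
      exact max_eq_right hx
    rw [Measure.map_congr this, Measure.map_id]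
  have h2 : ((expMeasure r).restrict (Set.Ici M)ᶜ).map (max M) =
      ENNReal.ofReal (1 - p) • Measure.dirac M := by
    have : max M =ᵐ[(expMeasure r).restrict (Set.Ici M)ᶜ] fun _ => M := by
      filter_upwards [ae_restrict_mem measurableSet_Ici.compl] with x hx
      exact max_eq_left (le_of_not_ge hx)
    rw [Measure.map_congr this, Measure.map_const, Measure.restrict_apply_univ, hIio]
  rw [← Measure.restrict_add_restrict_compl (μ := expMeasure r) (measurableSet_Ici (a := M)),
    Measure.map_add _ _ hmax, h1, h2, Measure.restrict_add_restrict_compl measurableSet_Ici,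
    expMeasure_restrict_Ici hM]

/-- Choosing a binomial size and then a uniformly random subset of that size amounts to putting
every element into the subset independently with probability `p`. -/
lemma lintegral_uniformOn_binomial {β : Type*} [Fintype β] (p : unitInterval)
    (F : Finset β → ENNReal) :
    ∫⁻ k, ∫⁻ I, F I ∂uniformOn {I : Finset β | I.card = k} ∂binomial (Fintype.card β) p =
      ∑ I, ENNReal.ofReal ((p : ℝ) ^ I.card * (1 - p) ^ (Fintype.card β - I.card)) * F I := by
  classical
  set n := Fintype.card β with hn
  have hunif : ∀ (k : ℕ) (I : Finset β), uniformOn {I : Finset β | I.card = k} {I} =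
      ({I.card} : Set ℕ).indicator (fun _ => ((n.choose I.card : ℕ) : ENNReal)⁻¹) k := by
    intro k I
    have hset : {I : Finset β | I.card = k} =
        ((Finset.univ.powersetCard k : Finset (Finset β)) : Set (Finset β)) := by
      ext J
      simp
    rw [hset, ← Finset.coe_singleton, uniformOn_apply_finset, Finset.card_powersetCard,
      Finset.card_univ]
    by_cases hk : k = I.card
    · subst hk
      rw [Set.indicator_of_mem (Set.mem_singleton _), Finset.inter_singleton_of_mem (by simp)]
      simp [hn]
    · rw [Set.indicator_of_notMem (by simpa using hk),
        Finset.inter_singleton_of_notMem (by simpa [eq_comm] using hk)]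
      simp
  simp_rw [lintegral_fintype, hunif]
  rw [lintegral_finsetSum _ fun I _ => .of_discrete]
  refine Finset.sum_congr rfl fun I _ => ?_
  rw [lintegral_const_mul _ .of_discrete, lintegral_indicator (measurableSet_singleton _),
    lintegral_const, Measure.restrict_apply_univ, binomial_singleton, mul_assoc,
    ENNReal.ofReal_mul (by positivity), ENNReal.ofReal_natCast,
    ENNReal.inv_mul_cancel_left, mul_comm]
  · simpa using (Nat.choose_pos (Finset.card_le_univ I)).ne'
  · simp

/-- The noise of the bottom candidates is distributed as independent exponential variables
truncated from below at `M`. -/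
theorem bottomNoise_eq_pi {β : Type*} [Fintype β] {r M : ℝ} (hr : 0 < r) (hM : 0 ≤ M) :
    bottomNoise β r M = Measure.pi fun _ : β => (expMeasure r).map (max M) := by
  classical
  have := isProbabilityMeasure_expMeasure hr
  have hmax : Measurable (max M) := measurable_const.max measurable_id
  have : IsProbabilityMeasure ((expMeasure r).map (max M)) :=
    Measure.isProbabilityMeasure_map hmax.aemeasurable
  have hp1 : Real.exp (-(r * M)) ≤ 1 := Real.exp_le_one_iff.2 (by nlinarith)
  set p := Real.exp (-(r * M)) with hp
  have hp0 : 0 ≤ p := (Real.exp_pos _).le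
  refine (Measure.pi_eq fun s hs => ?_).symm
  -- the probability of the box `∏ s e`, given that exactly the candidates in `I` exceed `M`
  have hI : ∀ I : Finset β, ((Measure.pi fun _ : I => expMeasure r).map
      fun Y e => if h : e ∈ I then M + Y ⟨e, h⟩ else M) (Set.univ.pi s) =
      (∏ e ∈ I, (expMeasure r).map (M + ·) (s e)) * ∏ e ∈ Iᶜ, Measure.dirac M (s e) := by
    intro I
    have hmeas : Measurable fun (Y : I → ℝ) e => if h : e ∈ I then M + Y ⟨e, h⟩ else M := by
      refine measurable_pi_iff.2 fun e => ?_
      by_cases h : e ∈ I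
      · simp only [h, dite_true]
        fun_prop
      · simp [h]
    rw [Measure.map_apply hmeas (MeasurableSet.univ_pi hs)]
    by_cases hall : ∀ e ∈ Iᶜ, M ∈ s e
    · have hpre : (fun (Y : I → ℝ) e => if h : e ∈ I then M + Y ⟨e, h⟩ else M) ⁻¹' Set.univ.pi s =
          Set.univ.pi fun e : I => (M + ·) ⁻¹' s e := by
        ext Y
        simp only [Set.mem_preimage, Set.mem_pi, Set.mem_univ, true_implies]
        refine ⟨fun h e => by simpa using h e, fun h e => ?_⟩
        by_cases he : e ∈ I
        · simpa [he] using h ⟨e, he⟩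
        · simpa [he] using hall e (by simpa using he)
      rw [hpre, Measure.pi_pi, Finset.prod_eq_one (s := Iᶜ) fun e he => by
        rw [Measure.dirac_apply' _ (hs e), Set.indicator_of_mem (hall e he), Pi.one_apply],
        mul_one, ← Finset.prod_coe_sort I]
      exact Finset.prod_congr rfl fun e _ =>
        (Measure.map_apply (measurable_const_add M) (hs e)).symm
    · push Not at hall
      obtain ⟨e, he, hes⟩ := hall
      rw [Finset.prod_eq_zero he (by
        rw [Measure.dirac_apply' _ (hs e), Set.indicator_of_notMem hes]), mul_zero]
      convert measure_empty (μ := Measure.pi fun _ : I => expMeasure r)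
      ext Y
      simp only [Set.mem_preimage, Set.mem_empty_iff_false, iff_false]
      intro h
      have := h e (Set.mem_univ e)
      simp only [dif_neg (Finset.mem_compl.1 he)] at this
      exact hes this
  have hproj : ((Set.projIcc (0 : ℝ) 1 zero_le_one p : unitInterval) : ℝ) = p := by
    rw [Set.projIcc_of_mem zero_le_one ⟨hp0, hp1⟩]
  rw [bottomNoise,
    Measure.bind_apply (MeasurableSet.univ_pi hs) Measurable.of_discrete.aemeasurable]
  simp_rw [Measure.bind_apply (MeasurableSet.univ_pi hs)
    (Measurable.of_discrete (α := Finset β)).aemeasurable]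
  rw [lintegral_uniformOn_binomial, hproj, expMeasure_map_max hr hM]
  simp only [Measure.add_apply, Measure.smul_apply, smul_eq_mul]
  rw [Fintype.prod_add]
  refine Finset.sum_congr rfl fun I _ => ?_
  rw [hI, Finset.prod_mul_distrib, Finset.prod_mul_distrib, Finset.prod_const, Finset.prod_const,
    Finset.card_compl, ENNReal.ofReal_mul (by positivity), ENNReal.ofReal_pow hp0,
    ENNReal.ofReal_pow (sub_nonneg.2 hp1)]
  ring

/-! ### The maximum and the maximizer of independent variables -/

section Max

variable {β : Type*} [Fintype β]

lemma measurable_iSup_apply : Measurable fun x : β → ℝ => ⨆ i, x i :=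
  Measurable.iSup measurable_pi_apply

/-- The maximum and the maximizer jointly: exchanging two coordinates preserves the product law and
the maximum, hence all maximizers are equally likely for any given range `A` of the maximum. -/
lemma measure_iSup_mem_argmax_eq [Nonempty β] [MeasurableSpace β] [MeasurableSingletonClass β]
    (μ : Measure ℝ) [IsProbabilityMeasure μ] [NullSingletonClass μ] {A : Set ℝ}
    (hA : MeasurableSet A) (a b : β) :
    Measure.pi (fun _ : β => μ) {x | (⨆ i, x i) ∈ A ∧ argmax x = a} =
      Measure.pi (fun _ : β => μ) {x | (⨆ i, x i) ∈ A ∧ argmax x = b} := by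
  classical
  set P := Measure.pi fun _ : β => μ
  set σ := Equiv.swap a b
  have hmeas : Measurable fun (x : β → ℝ) j => x (σ j) := by fun_prop
  have hset : MeasurableSet {x : β → ℝ | (⨆ i, x i) ∈ A ∧ argmax x = a} :=
    (measurable_iSup_apply hA).inter (measurable_argmax (measurableSet_singleton a))
  have hP : P.map (fun x j => x (σ j)) = P := pi_map_comp_injective μ σ.injective
  conv_lhs => rw [← hP, Measure.map_apply hmeas hset]
  refine measure_congr ?_
  filter_upwards [ae_pi_no_ties μ fun _ : β => (0 : ℝ)] with x hx
  refine propext ?_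
  have hsup : ⨆ i, x (σ i) = ⨆ i, x i := σ.iSup_comp
  have harg : argmax (fun j => x (σ j)) = σ (argmax x) := by
    refine argmax_eq_of_forall_lt fun j hj => ?_
    have hσ : σ (σ (argmax x)) = argmax x := Equiv.apply_symm_apply σ _
    rw [hσ]
    refine lt_of_le_of_ne (le_argmax x (σ j)) fun h => hx (σ j) (argmax x) ?_ (by simpa using h)
    intro h'
    exact hj (by rw [← h']; exact (Equiv.apply_symm_apply σ j).symm)
  change ((⨆ i, x (σ i)) ∈ A ∧ argmax (fun j => x (σ j)) = a) ↔ ((⨆ i, x i) ∈ A ∧ argmax x = b)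
  rw [hsup, harg, Equiv.swap_apply_eq_iff, Equiv.swap_apply_left]

end Max

/-- The maximum of independent variables with a common atomless law, indexed by a finite set `s`,
is independent of the maximizer, which is uniformly distributed on `s`. -/
theorem pi_map_iSup_argmax {α : Type*} [Finite α] [MeasurableSpace α] [MeasurableSingletonClass α]
    (s : Finset α) [Nonempty s] (μ : Measure ℝ) [IsProbabilityMeasure μ] [NullSingletonClass μ] :
    (Measure.pi fun _ : s => μ).map (fun x => ((⨆ i, x i), (argmax x : s).val)) =
      ((Measure.pi fun _ : s => μ).map fun x => ⨆ i, x i).prod (uniformOn (s : Set α)) := by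
  classical
  have hs : s.Nonempty := Finset.nonempty_coe_sort.1 inferInstance
  have : IsProbabilityMeasure (uniformOn (s : Set α)) :=
    isProbabilityMeasure_uniformOn s.finite_toSet hs
  have : IsProbabilityMeasure ((Measure.pi fun _ : s => μ).map fun x => ⨆ i, x i) :=
    Measure.isProbabilityMeasure_map measurable_iSup_apply.aemeasurable
  set P := Measure.pi fun _ : s => μ
  have hcard : (s.card : ENNReal) ≠ 0 := by simpa using hs.ne_empty
  have harg : Measurable fun x : s → ℝ => (argmax x : s).val :=
    measurable_subtype_coe.comp measurable_argmax
  have hjoint : Measurable fun x : s → ℝ => ((⨆ i, x i), (argmax x : s).val) :=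
    measurable_iSup_apply.prodMk harg
  refine (Measure.prod_eq fun A T hA hT => ?_).symm
  have hdisj : ∀ S : Finset s, P {x | (⨆ i, x i) ∈ A ∧ argmax x ∈ S} =
      ∑ a ∈ S, P {x | (⨆ i, x i) ∈ A ∧ argmax x = a} := by
    intro S
    rw [← measure_biUnion_finset]
    · congr 1
      ext x
      simp
    · intro a _ b _ hab
      exact Set.disjoint_left.2 fun x hxa hxb => hab (hxa.2.symm.trans hxb.2)
    · exact fun a _ => (measurable_iSup_apply hA).inter
        (measurable_argmax (measurableSet_singleton a))
  obtain ⟨a₀⟩ : Nonempty s := inferInstance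
  have hconst : ∀ S : Finset s, P {x | (⨆ i, x i) ∈ A ∧ argmax x ∈ S} =
      S.card * P {x | (⨆ i, x i) ∈ A ∧ argmax x = a₀} := by
    intro S
    rw [hdisj, Finset.sum_congr rfl fun a _ => measure_iSup_mem_argmax_eq μ hA a a₀,
      Finset.sum_const, nsmul_eq_mul]
  have htotal := hconst Finset.univ
  simp only [Finset.mem_univ, and_true, Finset.card_univ, Fintype.card_coe] at htotal
  have hpart := hconst (Finset.univ.filter fun a : s => (a : α) ∈ T)
  have hcardT : (Finset.univ.filter fun a : s => (a : α) ∈ T).card =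
      (s ∩ (Set.toFinite T).toFinset).card := by
    rw [← Finset.card_map (Function.Embedding.subtype _)]
    congr 1
    ext a
    simp [and_comm]
  have hpre : (fun x : s → ℝ => ((⨆ i, x i), (argmax x : s).val)) ⁻¹' (A ×ˢ T) =
      {x | (⨆ i, x i) ∈ A ∧ argmax x ∈ Finset.univ.filter fun a : s => (a : α) ∈ T} := by
    ext x
    simp
  have hT' : T = ((Set.toFinite T).toFinset : Set α) := by simp
  rw [Measure.map_apply hjoint (hA.prod hT), Measure.map_apply measurable_iSup_apply hA, hpre,
    hpart, hcardT]
  conv_rhs => rw [hT', uniformOn_apply_finset]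
  change _ = P {x | (⨆ i, x i) ∈ A} * _
  rw [htotal, mul_right_comm, ENNReal.mul_div_cancel hcard (by simp)]

/-- `MaxExp` does not depend on how the variables are indexed. -/
lemma maxExp_eq_map_pi {κ : Type*} [Fintype κ] {n : ℕ} (hn : Fintype.card κ = n) {r : ℝ}
    (hr : 0 < r) [Nonempty κ] :
    maxExp n r = (Measure.pi fun _ : κ => expMeasure r).map fun x => ⨆ i, x i := by
  subst hn
  have := isProbabilityMeasure_expMeasure hr
  let e := (Fintype.equivFin κ).symm
  have : Nonempty (Fin (Fintype.card κ)) := e.nonempty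
  rw [maxExp, ← pi_map_comp_injective (expMeasure r) e.injective,
    Measure.map_map measurable_iSup_apply (by fun_prop)]
  congr 1
  ext x
  exact e.iSup_comp (g := x)

/-! ### The fast simulation -/

section Simulation

/-- Independent copies indexed by `ι` split into independent blocks, along an injection of the
disjoint union of `κ` and the `γ t` into `ι`. -/
lemma pi_map_blocks {ι κ T X : Type*} {γ : T → Type*} [Fintype ι] [Fintype κ] [Fintype T]
    [∀ t, Fintype (γ t)] [MeasurableSpace X] (μ : Measure X) [IsProbabilityMeasure μ]
    {e : (Σ t, γ t) ⊕ κ → ι} (he : Function.Injective e) :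
    (Measure.pi fun _ : ι => μ).map
        (fun x => (fun t k => x (e (.inl ⟨t, k⟩)), fun j => x (e (.inr j)))) =
      (Measure.pi fun t => Measure.pi fun _ : γ t => μ).prod (Measure.pi fun _ : κ => μ) := by
  have h1 : (Measure.pi fun _ : Σ t, γ t => μ).map (MeasurableEquiv.piCurry fun _ _ => X) =
      Measure.pi fun t => Measure.pi fun _ : γ t => μ := by
    have := Measure.infinitePi_map_piCurry (X := fun (t : T) (_ : γ t) => X) fun _ _ => μ
    simpa only [Measure.infinitePi_eq_pi] using this
  have h2 := (measurePreserving_sumPiEquivProdPi fun _ : (Σ t, γ t) ⊕ κ => μ).map_eq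
  rw [← h1]
  conv_rhs => rw [← Measure.map_id (μ := Measure.pi fun _ : κ => μ)]
  rw [Measure.map_prod_map _ _ (MeasurableEquiv.measurable _) measurable_id, ← h2,
    ← pi_map_comp_injective μ he,
    Measure.map_map (MeasurableEquiv.measurable _) (by fun_prop),
    Measure.map_map ((MeasurableEquiv.measurable _).prodMap measurable_id)
      ((MeasurableEquiv.measurable _).comp (by fun_prop))]
  rfl

variable {α : Type*} [Fintype α] [Nonempty α]

lemma mem_bottomSet {w : α → ℝ} {M : ℝ} {e : α} :
    e ∈ bottomSet w M ↔ w e < Finset.univ.sup' Finset.univ_nonempty w - M := by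
  simp [bottomSet]

omit [Nonempty α] in
lemma mem_group {w : α → ℝ} {v : ℝ} {e : α} : e ∈ group w v ↔ w e = v := by
  simp [group]

lemma mem_topValues {w : α → ℝ} {M v : ℝ} :
    v ∈ topValues w M ↔ ∃ e, e ∉ bottomSet w M ∧ w e = v := by
  simp [topValues]

instance nonempty_group (w : α → ℝ) (M : ℝ) (v : topValues w M) : Nonempty (group w v) := by
  obtain ⟨e, -, he⟩ := mem_topValues.1 v.2
  exact ⟨⟨e, mem_group.2 he⟩⟩

/-- The random choices of the simulation, read off from one noise variable per candidate: the
maximum and the maximizer of the noise in each top group, and the noise of the bottom candidates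
truncated from below at `M`. -/
noncomputable def simulationCoupling (w : α → ℝ) (M : ℝ) (z : α → ℝ) :
    (topValues w M → ℝ) × (topValues w M → α) × (bottomSet w M → ℝ) :=
  (fun v => ⨆ e : group w v, z e, fun v => (argmax fun e : group w v => z e : group w v).val,
    fun e => max M (z e))

/-- Top groups and bottom set as disjoint blocks of candidates. -/
noncomputable def blockEmbedding (w : α → ℝ) (M : ℝ) :
    (Σ v : topValues w M, group w v) ⊕ bottomSet w M → α :=
  Sum.elim (fun p => p.2) fun e => e

lemma blockEmbedding_injective (w : α → ℝ) (M : ℝ) :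
    Function.Injective (blockEmbedding w M) := by
  refine Function.Injective.sumElim ?_ Subtype.val_injective ?_
  · rintro ⟨v, e⟩ ⟨v', e'⟩ h
    have h : e.val = e'.val := h
    obtain rfl : v = v' := Subtype.ext <| by
      rw [← mem_group.1 e.2, ← mem_group.1 e'.2, h]
    rw [Subtype.ext h]
  · rintro ⟨v, e⟩ e' h
    have h : e.val = e'.val := h
    obtain ⟨f, hf, hv⟩ := mem_topValues.1 v.2
    refine hf (mem_bottomSet.2 ?_)
    rw [hv, ← mem_group.1 e.2, h]
    exact mem_bottomSet.1 e'.2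

variable [MeasurableSpace α] [MeasurableSingletonClass α]

/-- The simulation draws the maxima, the representatives and the bottom noise with exactly the
joint law that they have when read off from independent exponential variables. -/
theorem map_simulationCoupling {r M : ℝ} (hr : 0 < r) (hM : 0 ≤ M) (w : α → ℝ) :
    Measurable (simulationCoupling w M) ∧
    (Measure.pi fun _ : α => expMeasure r).map (simulationCoupling w M) =
      (Measure.pi fun v : topValues w M => maxExp (group w v).card r).prod
        ((Measure.pi fun v : topValues w M => uniformOn (group w v : Set α)).prod
          (bottomNoise (bottomSet w M) r M)) := by
  have := isProbabilityMeasure_expMeasure hr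
  have := nullSingletonClass_expMeasure r
  have hmax : Measurable (max M) := measurable_const.max measurable_id
  have : IsProbabilityMeasure ((expMeasure r).map (max M)) :=
    Measure.isProbabilityMeasure_map hmax.aemeasurable
  have hexp : ∀ v : topValues w M, maxExp (group w v).card r =
      (Measure.pi fun _ : group w v => expMeasure r).map fun x => ⨆ i, x i :=
    fun v => maxExp_eq_map_pi (Fintype.card_coe _) hr
  have : ∀ v : topValues w M, IsProbabilityMeasure (maxExp (group w v).card r) := fun v => by
    rw [hexp]
    exact Measure.isProbabilityMeasure_map measurable_iSup_apply.aemeasurable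
  have : ∀ v : topValues w M, IsProbabilityMeasure (uniformOn (group w v : Set α)) := fun v =>
    isProbabilityMeasure_uniformOn (Finset.finite_toSet _)
      (Finset.nonempty_coe_sort.1 (nonempty_group w M v))
  have hjoint : ∀ v : topValues w M,
      Measurable fun x : group w v → ℝ => ((⨆ i, x i), (argmax x : group w v).val) := fun v =>
    measurable_iSup_apply.prodMk (measurable_subtype_coe.comp measurable_argmax)
  have hlaw : ∀ v : topValues w M, (Measure.pi fun _ : group w v => expMeasure r).map
      (fun x => ((⨆ i, x i), (argmax x : group w v).val)) =
      (maxExp (group w v).card r).prod (uniformOn (group w v : Set α)) := fun v => by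
    rw [pi_map_iSup_argmax, hexp]
  -- the blocks of noise, the statistics of each block, and a rearrangement of the components
  set blocks : (α → ℝ) → ((v : topValues w M) → group w v → ℝ) × (bottomSet w M → ℝ) :=
    fun z => (fun v e => z e, fun e => z e) with hblocks
  set stats : ((v : topValues w M) → group w v → ℝ) → topValues w M → ℝ × α :=
    fun y v => ((⨆ i, y v i), (argmax (y v) : group w v).val) with hstats
  set trunc : (bottomSet w M → ℝ) → bottomSet w M → ℝ := fun y e => max M (y e) with htrunc
  have hmblocks : Measurable blocks := by fun_prop
  have hmstats : Measurable stats :=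
    measurable_pi_iff.2 fun v => (hjoint v).comp (measurable_pi_apply v)
  have hmtrunc : Measurable trunc := by fun_prop
  have hmarrow := (MeasurableEquiv.arrowProdEquivProdArrow ℝ α (topValues w M)).measurable
  have hcomp : simulationCoupling w M = MeasurableEquiv.prodAssoc ∘
      Prod.map (MeasurableEquiv.arrowProdEquivProdArrow ℝ α (topValues w M)) id ∘
      Prod.map stats trunc ∘ blocks := rfl
  refine ⟨?_, ?_⟩
  · rw [hcomp]
    exact (MeasurableEquiv.measurable _).comp ((hmarrow.prodMap measurable_id).comp
      ((hmstats.prodMap hmtrunc).comp hmblocks))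
  have hmb : (Measure.pi fun _ : α => expMeasure r).map blocks =
      (Measure.pi fun v : topValues w M => Measure.pi fun _ : group w v => expMeasure r).prod
        (Measure.pi fun _ : bottomSet w M => expMeasure r) :=
    pi_map_blocks (expMeasure r) (blockEmbedding_injective w M)
  have hms : (Measure.pi fun v : topValues w M => Measure.pi fun _ : group w v =>
      expMeasure r).map stats = Measure.pi fun v : topValues w M =>
        (maxExp (group w v).card r).prod (uniformOn (group w v : Set α)) := by
    have : ∀ v : topValues w M, IsProbabilityMeasure
        ((Measure.pi fun _ : group w v => expMeasure r).map
          (fun x => ((⨆ i, x i), (argmax x : group w v).val))) := fun v =>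
      Measure.isProbabilityMeasure_map (hjoint v).aemeasurable
    simp_rw [← hlaw]
    exact Measure.pi_map_pi fun v => (hjoint v).aemeasurable
  have hmt : (Measure.pi fun _ : bottomSet w M => expMeasure r).map trunc =
      bottomNoise (bottomSet w M) r M := by
    rw [bottomNoise_eq_pi hr hM]
    exact Measure.pi_map_pi fun _ => hmax.aemeasurable
  have : IsProbabilityMeasure (bottomNoise (bottomSet w M) r M) := by
    rw [bottomNoise_eq_pi hr hM]
    infer_instance
  rw [hcomp, ← Measure.map_map (MeasurableEquiv.measurable _) (by fun_prop),
    ← Measure.map_map (by fun_prop) (by fun_prop), ← Measure.map_map (by fun_prop) hmblocks,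
    hmb, ← Measure.map_prod_map _ _ hmstats hmtrunc, hms, hmt,
    ← Measure.map_prod_map _ _ hmarrow measurable_id,
    (measurePreserving_arrowProdEquivProdArrow _ _ _ _ _).map_eq, Measure.map_id,
    (measurePreserving_prodAssoc _ _ _).map_eq]

omit [MeasurableSpace α] [MeasurableSingletonClass α] in
/-- Once the random choices are read off from candidate noises that are nonnegative and cause no
ties, the simulation selects the same candidate as report-noisy-max. The winner of report-noisy-max
has score at least `max w`, as the noise is nonnegative. If it is a top candidate, it is the
maximizer of its group; if it is a bottom candidate, its noise exceeds `M` and is not truncated;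
and a bottom candidate whose noise is truncated scores less than `max w`. -/
lemma argmax_combinedScore {M : ℝ} {w z : α → ℝ} (hz : ∀ e, 0 ≤ z e)
    (hties : ∀ e f, e ≠ f → w e + z e ≠ w f + z f) :
    argmax (combinedScore w M (simulationCoupling w M z).1 (simulationCoupling w M z).2.1
      (simulationCoupling w M z).2.2) = argmax fun e => w e + z e := by
  set a := argmax fun e => w e + z e with ha
  have hlt : ∀ e, e ≠ a → w e + z e < w a + z a := fun e he =>
    lt_of_le_of_ne (le_argmax (fun e => w e + z e) e) (hties e a he)
  have hle : ∀ e, w e + z e ≤ w a + z a := le_argmax fun e => w e + z e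
  set m := Finset.univ.sup' Finset.univ_nonempty w with hm
  have hma : m ≤ w a + z a :=
    Finset.sup'_le _ _ fun e _ => (le_add_of_nonneg_right (hz e)).trans (hle e)
  -- the noise of a top group is attained by its representative
  have hsup : ∀ v : topValues w M, ⨆ e : group w v, z e =
      z (argmax fun e : group w v => z e : group w v) := fun v =>
    le_antisymm (ciSup_le fun e => le_argmax (fun e : group w v => z e) e)
      (le_ciSup (f := fun e : group w v => z e) (Set.finite_range _).bddAbove _)
  have hscore_a : combinedScore w M (simulationCoupling w M z).1 (simulationCoupling w M z).2.1
      (simulationCoupling w M z).2.2 a = ((w a + z a : ℝ) : EReal) := by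
    by_cases hab : a ∈ bottomSet w M
    · have : M ≤ z a := by
        have := mem_bottomSet.1 hab
        linarith
      rw [combinedScore, dif_pos hab]
      simp only [simulationCoupling, max_eq_right this]
    · rw [combinedScore, dif_neg hab]
      set v : topValues w M := ⟨w a, mem_topValues.2 ⟨a, hab, rfl⟩⟩ with hv
      have : Nonempty (group w v) := nonempty_group w M v
      have hrep : (argmax fun e : group w v => z e : group w v) = ⟨a, mem_group.2 rfl⟩ := by
        refine argmax_eq_of_forall_lt fun e he => ?_
        have h1 := hlt e fun h => he (Subtype.ext h)
        have h2 : w e = w a := mem_group.1 e.2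
        change z e < z a
        linarith
      have hrep' : (simulationCoupling w M z).2.1 v = a := congrArg Subtype.val hrep
      have hsup' : (simulationCoupling w M z).1 v = z a :=
        (hsup v).trans (congrArg z hrep')
      exact (if_pos hrep').trans (by rw [hsup'])
  refine argmax_eq_of_forall_lt fun e he => ?_
  rw [hscore_a]
  by_cases heb : e ∈ bottomSet w M
  · rw [combinedScore, dif_pos heb, EReal.coe_lt_coe_iff]
    have h1 := mem_bottomSet.1 heb
    have h2 := hlt e he
    change w e + max M (z e) < _
    rcases max_cases M (z e) with ⟨h, -⟩ | ⟨h, -⟩ <;> rw [h] <;> linarith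
  · rw [combinedScore, dif_neg heb]
    set v : topValues w M := ⟨w e, mem_topValues.2 ⟨e, heb, rfl⟩⟩ with hv
    by_cases hrep : (simulationCoupling w M z).2.1 v = e
    · refine (if_pos hrep).trans_lt ?_
      rw [EReal.coe_lt_coe_iff]
      have : (simulationCoupling w M z).1 v = z e :=
        (hsup v).trans (congrArg z hrep)
      rw [this]
      exact hlt e he
    · exact (if_neg hrep).trans_lt (EReal.bot_lt_coe _)

lemma measurable_argmax_combinedScore (w : α → ℝ) (M : ℝ) :
    Measurable fun ω : (topValues w M → ℝ) × (topValues w M → α) × (bottomSet w M → ℝ) =>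
      argmax (combinedScore w M ω.1 ω.2.1 ω.2.2) := by
  refine measurable_argmax.comp (measurable_pi_iff.2 fun e => ?_)
  by_cases he : e ∈ bottomSet w M
  · simp only [combinedScore, dif_pos he]
    exact measurable_coe_real_ereal.comp (by fun_prop)
  · simp only [combinedScore, dif_neg he]
    refine Measurable.ite ?_ (measurable_coe_real_ereal.comp (by fun_prop)) measurable_const
    exact measurableSet_eq_fun (by fun_prop) measurable_const

/-- The simulation is report-noisy-max with exponential noise, for every threshold `M ≥ 0`. -/
theorem fastRNM_eq {r M : ℝ} (hr : 0 < r) (hM : 0 ≤ M) (w : α → ℝ) :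
    fastRNM r M w =
      (Measure.pi fun _ : α => expMeasure r).map fun z => argmax fun e => w e + z e := by
  have := isProbabilityMeasure_expMeasure hr
  have := nullSingletonClass_expMeasure r
  obtain ⟨hmeas, hlaw⟩ := map_simulationCoupling hr hM w
  rw [fastRNM, ← hlaw, Measure.map_map (measurable_argmax_combinedScore w M) hmeas]
  refine Measure.map_congr ?_
  have hnonneg : ∀ᵐ z ∂Measure.pi fun _ : α => expMeasure r, ∀ e, 0 ≤ z e :=
    ae_all_iff.2 fun e =>
      (measurePreserving_eval (fun _ : α => expMeasure r) e).quasiMeasurePreserving.ae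
        (ae_nonneg_expMeasure r)
  filter_upwards [hnonneg, ae_pi_no_ties (expMeasure r) w] with z hz hties
  exact argmax_combinedScore hz hties

theorem fasterDiscretizedRNM_eq {n : ℕ} {ρ Δ : ℝ} (hΔ : 0 < Δ) (hρ : 0 < ρ) (w : α → ℝ) :
    fasterDiscretizedRNM n (√(2 * ρ) / (4 * Δ)) ρ Δ w = discretizedRNM (√(2 * ρ)) Δ Δ w := by
  have hε : 0 < √(2 * ρ) := Real.sqrt_pos.2 (by positivity)
  have hM : 0 ≤ 4 * √(n : ℝ) * Real.log n * Δ / √ρ := by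
    have := Real.log_natCast_nonneg n
    positivity
  rw [fasterDiscretizedRNM, fastRNM_eq (by positivity) hM, discretizedRNM,
    show 2 * (Δ + Δ) = 4 * Δ by ring]

end Simulation

/-! ### The law and the privacy of the mechanism -/

theorem mainTheorem5 {V : Type*} [Fintype V] (G : SimpleGraph V) (E' : Finset G.edgeSet)
    [Nonempty E'] (Δ ρ : ℝ) (hΔ : 0 < Δ) (hρ : 0 < ρ) :
    (∀ w : G.edgeSet → ℝ,
      fasterDiscretizedRNM (Fintype.card V) (√(2 * ρ) / (4 * Δ)) ρ Δ (fun e : E' => w e) =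
        discretizedRNM (√(2 * ρ)) Δ Δ (fun e : E' => w e)) ∧
    IsZCDP (LInftyNeighboring Δ) ρ (fun w : G.edgeSet → ℝ =>
      fasterDiscretizedRNM (Fintype.card V) (√(2 * ρ) / (4 * Δ)) ρ Δ (fun e : E' => w e)) := by
  have heq : ∀ w : G.edgeSet → ℝ,
      fasterDiscretizedRNM (Fintype.card V) (√(2 * ρ) / (4 * Δ)) ρ Δ (fun e : E' => w e) =
        discretizedRNM (√(2 * ρ)) Δ Δ (fun e : E' => w e) :=
    fun w => fasterDiscretizedRNM_eq hΔ hρ _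
  have hε : 0 < √(2 * ρ) := Real.sqrt_pos.2 (by positivity)
  have hprob : ∀ w : G.edgeSet → ℝ,
      IsProbabilityMeasure (discretizedRNM (√(2 * ρ)) Δ Δ (fun e : E' => w e)) :=
    fun w => isProbabilityMeasure_discretizedRNM (by positivity) _
  refine ⟨heq, ?_⟩
  simp only [heq]
  refine ⟨hprob, fun w w' h a ha => ?_⟩
  have hPw := hprob w
  have hPw' := hprob w'
  have hρε : √(2 * ρ) ^ 2 / 2 = ρ := by
    rw [Real.sq_sqrt (by positivity)]
    ring
  have hle := renyiDiv_le_of_le_smul ha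
    (discretizedRNM_le_smul hε hΔ fun e : E' => h e)
    (discretizedRNM_le_smul hε hΔ fun e : E' => (abs_sub_comm _ _).trans_le (h e))
  rwa [hρε] at hle
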